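/- Let $\mathfrak C$ be a Grothendieck category which is semi-Artinian, i.e. the smallest hereditary torsion class of $\mathfrak C$ (a class of objects such that the middle term of a short exact sequence belongs to it if and only if both outer terms do, and which is closed under coproducts) containing all the simple objects is $\mathfrak C$ itself. A *length function* on $\mathfrak C$ is a map $L$ from the objects of $\mathfrak C$ to $\mathbb R_{\ge 0}\cup\{\infty\}$ such that $L(X)=L(Y)$ if $X\cong Y$, $L(0)=0$, $L(X_2)=L(X_1)+L(X_3)$ for every short exact sequence $0\to X_1\to X_2\to X_3\to 0$, and $L(X)=\sup_{\alpha} L(X_\alpha)$ whenever $X$ is the join $\sum_\alpha X_\alpha$ of a directed set of subobjects $X_\alpha$. Let $\mathrm{Sp}(\mathfrak C)$ be the set of isomorphism classes of simple objects, and for $\pi\in\mathrm{Sp}(\mathfrak C)$ let $S(\pi)$ be a simple object in the class $\pi$, with injective envelope $E(S(\pi))$. Let $\mathcal T_\pi=\{M\in\mathfrak C:\operatorname{Hom}_{\mathfrak C}(M,E(S(\pi)))=0\}$, let $\mathbf Q_\pi:\mathfrak C\to\mathfrak C/\mathcal T_\pi$ be the localization functor, and put $$\ell_\pi(M)=\ell(\mathbf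 Q_\pi(M))\in\mathbb R_{\ge0}\cup\{\infty\}\qquad(M\in\mathfrak C),$$ where $\ell(X)$, the composition length of $X$, is the supremum of the lengths $n$ of the chains $0=X_0\lneq X_1\lneq\dots\lneq X_n=X$ of subobjects of $X$. Each $\ell_\pi$ is a length function (the *atomic length function* of $\pi$), and for every length function $L$ on $\mathfrak C$ $$L=\sum_{\pi\in\mathrm{Sp}(\mathfrak C)}L(S(\pi))\cdot\ell_\pi ,$$ where $\infty\cdot0=0\cdot\infty=0$ and a sum is the supremum of its finite partial sums. Moreover the coefficients are uniquely determined by $L$: if $\mu(\pi)\in\mathbb R_{\ge0}\cup\{\infty\}$ ($\pi\in\mathrm{Sp}(\mathfrak C)$) are such that $L=\sum_{\pi}\mu(\pi)\cdot\ell_\pi$, then $\mu(\pi)=L(S(\pi))$ for all $\pi$. -/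

import Mathlib

open CategoryTheory CategoryTheory.Limits
open scoped ENNReal ZeroObject

universe w v u

namespace LengthFunctions

section Basic

variable {C : Type u} [Category.{v} C] [Abelian C]

/-- A length function on an abelian category: an isomorphism-invariant function on objects with
values in `[0, ∞]` which vanishes on zero objects, is additive on short exact sequences, and is
upper continuous, that is, continuous on direct unions of subobjects. -/
structure IsLengthFunction (L : C → ℝ≥0∞) : Prop where
  /-- `L` takes equal values on isomorphic objects -/
  iso_invariant : ∀ ⦃X Y : C⦄, Nonempty (X ≅ Y) → L X = L Y
  /-- `L 0 = 0` -/
  zero : ∀ ⦃X : C⦄, IsZero X → L X = 0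
  /-- `L X₂ = L X₁ + L X₃` for every short exact sequence `0 ⟶ X₁ ⟶ X₂ ⟶ X₃ ⟶ 0` -/
  additive : ∀ ⦃S : ShortComplex C⦄, S.ShortExact → L S.X₂ = L S.X₁ + L S.X₃
  /-- if `X` is the join of a directed set `s` of subobjects of `X`, then `L X` is the supremum
  of the values of `L` on the members of `s` -/
  upper_continuous : ∀ ⦃X : C⦄ (s : Set (Subobject X)), s.Nonempty → DirectedOn (· ≤ ·) s →
    IsLUB s ⊤ → L X = ⨆ Y ∈ s, L (Y : C)

/-- A hereditary torsion class: a class of objects such that the middle term of a short exact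
sequence belongs to it if and only if both outer terms do (a Serre class), and which is closed
under coproducts. -/
structure IsHereditaryTorsionClass (T : ObjectProperty C) : Prop where
  /-- `T` contains the zero objects and is closed under subobjects, quotients and extensions -/
  isSerreClass : T.IsSerreClass
  /-- `T` is closed under coproducts of families indexed by types in the universe `w` -/
  coproducts : ∀ (J : Type w), T.IsClosedUnderColimitsOfShape (Discrete J)

/-- The first layer of the Gabriel filtration: the smallest hereditary torsion class which
contains all the simple objects. -/
def gabrielZero : ObjectProperty C := fun M =>
  ∀ T : ObjectProperty C, IsHereditaryTorsionClass.{w} T → (∀ S : C, Simple S → T S) → T M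

variable (C) in
/-- A category is semi-Artinian (of Gabriel dimension `0`) if the smallest hereditary torsion class
which contains all the simple objects consists of all the objects. (The zero category, whose Gabriel
dimension is usually set to `-1`, is not excluded.) -/
def IsSemiArtinian : Prop := ∀ M : C, gabrielZero.{w} M

/-- A monomorphism `i : X ⟶ E` is an injective envelope if `E` is injective and `i` is essential. -/
structure IsInjectiveEnvelope {X E : C} (i : X ⟶ E) : Prop where
  mono : Mono i
  injective : Injective E
  essential : ∀ ⦃Z : C⦄ (g : E ⟶ Z), Mono (i ≫ g) → Mono g

/-- The torsion class `{M | Hom(M, E(S)) = 0}` of an object `S`, where `S ⟶ E(S)` is an injective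
envelope. In a Grothendieck category, `E(S)` exists and is unique up to isomorphism, so that it
does not matter which one is taken. -/
def torsionClass (S : C) : ObjectProperty C := fun M =>
  ∀ ⦃E : C⦄ (i : S ⟶ E), IsInjectiveEnvelope i → ∀ f : M ⟶ E, f = 0

instance torsionClass_isSerreClass (S : C) : (torsionClass S).IsSerreClass where
  exists_zero := ⟨0, isZero_zero C, fun _ _ _ f => (isZero_zero C).eq_of_src f 0⟩
  prop_of_mono {X Y} f _ hY := fun E i hi g => by
    have := hi.injective
    rw [← Injective.comp_factorThru g f, hY i hi (Injective.factorThru g f), comp_zero]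
  prop_of_epi {X Y} f _ hX := fun E i hi g => by
    rw [← cancel_epi f, hX i hi (f ≫ g), comp_zero]
  prop_X₂_of_shortExact {T} hT h₁ h₃ := fun E i hi g => by
    have := hT.epi_g
    have h : T.f ≫ g = 0 := h₁ i hi (T.f ≫ g)
    rw [← hT.exact.g_desc g h, h₃ i hi (hT.exact.desc g h), comp_zero]

end Basic

section Lattice

/-- The length of a bounded ordered set (a lattice, in practice): the supremum of the lengths `n` of
its series `0 = x₀ < x₁ < ⋯ < xₙ = 1`. -/
noncomputable def seriesLength (α : Type*) [Preorder α] : ℝ≥0∞ :=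
  ⨆ σ : {σ : LTSeries α // IsBot σ.head ∧ IsTop σ.last}, (σ.1.length : ℝ≥0∞)

/-- The composition length of an object: the length of its lattice of subobjects. -/
noncomputable def compositionLength {D : Type*} [Category* D] (X : D) : ℝ≥0∞ :=
  seriesLength (Subobject X)

end Lattice

section Spectrum

variable (C : Type u) [Category.{v} C] [Abelian C]

/-- Isomorphism, as an equivalence relation on the simple objects. -/
def simpleSetoid : Setoid {S : C // Simple S} where
  r S T := Nonempty (S.1 ≅ T.1)
  iseqv :=
    { refl := fun S => ⟨Iso.refl S.1⟩
      symm := fun ⟨e⟩ => ⟨e.symm⟩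
      trans := fun ⟨e⟩ ⟨e'⟩ => ⟨e ≪≫ e'⟩ }

/-- The spectrum: the isomorphism classes of simple objects. -/
def Sp : Type u := Quotient (simpleSetoid C)

variable {C}

/-- The simple object `S(π)` (a representative of the isomorphism class `π`). -/
noncomputable def Sp.obj (π : Sp C) : C := (Quotient.out (s := simpleSetoid C) π).1

/-- The atomic length function of `π`: the composition length in the quotient category `C/T_π`,
with `T_π = {M | Hom(M, E(S(π))) = 0}`, of the image under the localization functor `C ⥤ C/T_π`.
The quotient category is the localization at the morphisms whose kernel and cokernel
belong to `T_π`. -/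
noncomputable def atomicLength (π : Sp C) (M : C) : ℝ≥0∞ :=
  compositionLength ((torsionClass π.obj).isoModSerre.Q.obj M)

end Spectrum

end LengthFunctions

/-! The key is to read ℓ_π(M) as the multiplicity of S = S(π) in M: the supremum of the numbers of
factors isomorphic to S in finite chains of subobjects of M (`atomicLength_eq_multiplicity`). Every
subobject of the image of M in the quotient category comes from a subobject N of M. If M/N is not
torsion, a nonzero map M/N → E(S) exhibits S as a subquotient of M/N, because S is essential in
E(S); conversely S itself is not torsion. So strict inclusions in the quotient category correspond
to factors S in M (`hasLength_localization_iff`).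

Multiplicity is a length function: each factor of a chain goes either to the kernel or to the image
of a morphism, which gives additivity, and upper continuity follows from AB5. On simple objects the
multiplicities form a Kronecker delta. Hence ∑ L(S(π)) ℓ_π is a length function that agrees with L
on simple objects, and any coefficients are recovered by evaluating at S(π).

It remains that length functions L, L' which agree on simple objects agree everywhere
(`IsLengthFunction.eq_of_simple`): the objects on which they agree form a hereditary torsion class.
Agreement is required on all subquotients (`AgreeOn`), since L(M) = L'(M) = ∞ would say nothing
about subobjects of M. -/

namespace LengthFunctions

/-! ### Directed joins of subobjects (AB5) and injective envelopes -/

section Grothendieck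

variable {C : Type u} [Category.{v} C] [Abelian C]

/-- By AB5 the join is the filtered colimit of the members of `s`, and a filtered colimit of
monomorphisms into the constant diagram `Z` is a monomorphism. -/
lemma mono_arrow_comp_of_isLUB [IsGrothendieckAbelian.{w} C] {X Z : C} {s : Set (Subobject X)}
    (hs : s.Nonempty) (hd : DirectedOn (· ≤ ·) s) {U : Subobject X} (hU : IsLUB s U) (g : X ⟶ Z)
    (h : ∀ Y ∈ s, Mono (Y.arrow ≫ g)) : Mono (U.arrow ≫ g) := by
  obtain ⟨J, ⟨e⟩⟩ : ∃ J : Type w, Nonempty (J ≃ s) := ⟨_, ⟨(equivShrink s).symm⟩⟩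
  let : Preorder J := Preorder.lift e
  have he {j j' : J} (h : j ≤ j') : (e j).1 ≤ (e j').1 := h
  have : Nonempty J := hs.to_subtype.map e.symm
  have : IsDirectedOrder J := ⟨fun a b => by
    obtain ⟨c, hc, hac, hbc⟩ := hd _ (e a).2 _ (e b).2
    refine ⟨e.symm ⟨c, hc⟩, ?_, ?_⟩
    · change e a ≤ e (e.symm _)
      rwa [e.apply_symm_apply]
    · change e b ≤ e (e.symm _)
      rwa [e.apply_symm_apply]⟩
  let F : J ⥤ MonoOver X :=
    { obj j := MonoOver.mk (e j).1.arrow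
      map {j j'} f := MonoOver.homMk (Subobject.ofLE _ _ (he (leOfHom f))) }
  let c : Cocone (F ⋙ MonoOver.forget _) := Cocone.mk (Over.mk U.arrow)
    { app j := Over.homMk (Subobject.ofLE (e j).1 U (hU.1 (e j).2)) (Subobject.ofLE_arrow _)
      naturality j j' f := by
        ext
        change Subobject.ofLE _ _ (he (leOfHom f)) ≫ Subobject.ofLE _ _ _ = Subobject.ofLE _ _ _ ≫ 𝟙 _
        simp }
  have hm : Mono c.pt.hom := by dsimp [c]; infer_instance
  have hc := IsGrothendieckAbelian.isColimitMapCoconeOfSubobjectMkEqISup F c (by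
    change Subobject.mk U.arrow = ⨆ j, Subobject.mk (e j).1.arrow
    simp only [Subobject.mk_arrow]
    rw [e.iSup_congr (g := fun y : s => (y : Subobject X)) (fun _ => rfl), ← sSup_eq_iSup']
    exact hU.sSup_eq.symm)
  let α : F ⋙ MonoOver.forget _ ⋙ Over.forget _ ⟶ (Functor.const _).obj Z :=
    { app j := (e j).1.arrow ≫ g
      naturality j j' f := by
        change Subobject.ofLE _ _ (he (leOfHom f)) ≫ _ ≫ g = (_ ≫ g) ≫ 𝟙 _
        simp }
  have : ∀ j, Mono (α.app j) := fun j => h _ (e j).2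
  have := NatTrans.mono_of_mono_app α
  -- Connectedness makes `Z` the colimit of the constant diagram.
  have := IsFiltered.isConnected J
  exact colim.map_mono' α hc (isColimitConstCocone J Z) (U.arrow ≫ g) (fun j => by
    change Subobject.ofLE _ _ _ ≫ U.arrow ≫ g = (_ ≫ g) ≫ 𝟙 _
    simp)

/-- A morphism from `B ⟶ X` which vanishes on the intersections of `B` with the members of a
directed family covering `X` is zero. -/
lemma eq_zero_of_pullback_fst_comp_eq_zero [IsGrothendieckAbelian.{w} C] {X B Z : C}
    {s : Set (Subobject X)} (hs : s.Nonempty) (hd : DirectedOn (· ≤ ·) s) (hU : IsLUB s ⊤)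
    (b : B ⟶ X) [Mono b] (f : B ⟶ Z) (h : ∀ Y ∈ s, pullback.fst b Y.arrow ≫ f = 0) : f = 0 := by
  wlog hf : Epi f generalizing Z
  · have := this (factorThruImage f) (fun Y hY => by
      rw [← cancel_mono (image.ι f), Category.assoc, image.fac, h Y hY, zero_comp]) inferInstance
    rw [← image.fac f, this, zero_comp]
  -- With `f` epi, the pushout is X / ker f, and `k` is its projection onto X / B, with kernel Z. So
  -- Z vanishes once `k` is mono, which by AB5 can be tested on the images `N Y` of the members of
  -- `s`.
  obtain ⟨k, hk₁, hk₂⟩ : ∃ k : pushout b f ⟶ cokernel b,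
      pushout.inl b f ≫ k = cokernel.π b ∧ pushout.inr b f ≫ k = 0 :=
    ⟨pushout.desc (cokernel.π b) 0 (by simp), pushout.inl_desc _ _ _, pushout.inr_desc _ _ _⟩
  let N (Y : Subobject X) : Subobject (pushout b f) := imageSubobject (Y.arrow ≫ pushout.inl b f)
  have hN {Y Y' : Subobject X} (hY : Y ≤ Y') : N Y ≤ N Y' :=
    imageSubobject_le _ (Subobject.ofLE Y Y' hY ≫ factorThruImageSubobject _) (by
      rw [Category.assoc, imageSubobject_arrow_comp, Subobject.ofLE_arrow_assoc])
  have hk : Mono ((⊤ : Subobject (pushout b f)).arrow ≫ k) := by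
    refine mono_arrow_comp_of_isLUB.{w} (s := N '' s) (hs.image _) ?_ ⟨fun _ _ => le_top, ?_⟩ k ?_
    · rintro _ ⟨Y, hY, rfl⟩ _ ⟨Y', hY', rfl⟩
      obtain ⟨Y'', h'', h₁, h₂⟩ := hd Y hY Y' hY'
      exact ⟨_, ⟨Y'', h'', rfl⟩, hN h₁, hN h₂⟩
    · intro V hV
      have h₁ : ⊤ ≤ (Subobject.pullback (pushout.inl b f)).obj V := hU.2 (fun Y hY =>
        Subobject.le_of_comm ((Subobject.isPullback (pushout.inl b f) V).lift
          (factorThruImageSubobject _ ≫ Subobject.ofLE _ _ (hV ⟨Y, hY, rfl⟩)) Y.arrow (by simp))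
          (by simp))
      have h₂ : V.Factors (pushout.inl b f) := by
        have h₃ := (Subobject.isPullback (pushout.inl b f) V).w
        have h₄ : (⊤ : Subobject X).arrow ≫ pushout.inl b f =
            (Subobject.ofLE _ _ h₁ ≫ Subobject.pullbackπ _ _) ≫ V.arrow := by
          rw [Category.assoc, h₃, Subobject.ofLE_arrow_assoc]
        rw [← IsIso.inv_hom_id_assoc (⊤ : Subobject X).arrow (pushout.inl b f), h₄,
          ← Category.assoc]
        exact Subobject.factors_comp_arrow _
      -- `pushout.inl b f` is epi because `f` is.
      have : Epi V.arrow := epi_of_epi_fac (Subobject.factorThru_arrow _ _ h₂)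
      exact ((Subobject.isIso_arrow_iff_eq_top V).1 (isIso_of_mono_of_epi _)).ge
    · rintro _ ⟨Y, hY, rfl⟩
      -- Up to refinement, an element of `N Y` killed by `k` comes from Y ∩ B, where `f` vanishes.
      refine Preadditive.mono_of_cancel_zero _ fun {T} t ht => ?_
      obtain ⟨T', p, hp, x, hx⟩ := surjective_up_to_refinements_of_epi
        (factorThruImageSubobject (Y.arrow ≫ pushout.inl b f)) t
      have h₁ : (x ≫ Y.arrow) ≫ cokernel.π b = 0 := by
        have : p ≫ t ≫ (N Y).arrow ≫ k = 0 := by rw [ht, comp_zero]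
        rw [← Category.assoc, hx] at this
        simpa [N, hk₁] using this
      let y := (ShortComplex.exact_of_g_is_cokernel
        (ShortComplex.mk b _ (cokernel.condition _)) (cokernelIsCokernel _)).lift _ h₁
      have hy : y ≫ b = x ≫ Y.arrow := ShortComplex.Exact.lift_f _ _ _
      have hyf : y ≫ f = 0 := by
        rw [← pullback.lift_fst y x hy, Category.assoc, h Y hY, comp_zero]
      rw [← cancel_epi p, ← cancel_mono (N Y).arrow, hx]
      simp only [N, Category.assoc, imageSubobject_arrow_comp, comp_zero, zero_comp]
      rw [← Category.assoc, ← hy, Category.assoc, pushout.condition, ← Category.assoc, hyf,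
        zero_comp]
  have : Mono k := by
    rw [← IsIso.inv_hom_id_assoc (⊤ : Subobject (pushout b f)).arrow k]
    infer_instance
  rw [← cancel_mono (pushout.inr b f), ← cancel_mono k]
  simp [hk₂]

/-- The embedding `i` is essential in the subobject `N` of its target. -/
def IsEssentialIn {S I : C} (i : S ⟶ I) (N : Subobject I) : Prop :=
  ∀ ⦃W : C⦄ (g : I ⟶ W), Mono (i ≫ g) → Mono (N.arrow ≫ g)

/-- Essentiality is tested on maps out of all of `I`, so it passes to joins of chains by
`mono_arrow_comp_of_isLUB`, and Zorn's lemma applies. -/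
lemma exists_maximal_isEssentialIn [IsGrothendieckAbelian.{w} C] {S I : C} (i : S ⟶ I) [Mono i] :
    ∃ N : Subobject I, Subobject.mk i ≤ N ∧ Maximal (IsEssentialIn i) N := by
  refine zorn_le_nonempty₀ {N | IsEssentialIn i N} (fun c hc hch y hy => ?_) (Subobject.mk i) ?_
  · exact ⟨sSup c, fun W g hg => mono_arrow_comp_of_isLUB.{w} ⟨y, hy⟩ hch.directedOn
      (isLUB_sSup c) g (fun Y hY => hc hY g hg), fun z hz => le_sSup hz⟩
  · intro W g hg
    rw [← Subobject.underlyingIso_hom_comp_eq_mk, Category.assoc]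
    infer_instance

/-- The condition on `K` is K ∩ ker q = 0; a maximal such `K` is a pseudo-complement of ker q. -/
lemma exists_maximal_mono_comp [IsGrothendieckAbelian.{w} C] {I Z : C} (q : I ⟶ Z) :
    ∃ K : Subobject I, Maximal (fun K : Subobject I => Mono (K.arrow ≫ q)) K := by
  obtain ⟨K, -, hK⟩ := zorn_le_nonempty₀ {K : Subobject I | Mono (K.arrow ≫ q)}
    (fun c hc hch y hy => ⟨sSup c, mono_arrow_comp_of_isLUB.{w} ⟨y, hy⟩ hch.directedOn
      (isLUB_sSup c) q hc, fun z hz => le_sSup hz⟩) ⊥ (by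
      refine Preadditive.mono_of_cancel_zero _ fun t _ => ?_
      rw [← cancel_mono (⊥ : Subobject I).arrow]
      simp)
  exact ⟨K, hK⟩

/-- Objects of a Grothendieck category have injective envelopes. -/
lemma exists_isInjectiveEnvelope [IsGrothendieckAbelian.{w} C] (S : C) :
    ∃ (E : C) (i : S ⟶ E), IsInjectiveEnvelope i := by
  let I := Injective.under S
  let i : S ⟶ I := Injective.ι S
  -- `N` is a maximal essential extension of `S` in `I`, and `K` is maximal with N ∩ K = 0. Then N →
  -- I/K is an essential mono, so the inclusion of `N` extends to an embedding `h` of I/K into `I`.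
  -- Its image is essential over `S`, hence lies in `N`, which makes `N` a retract of `I`.
  obtain ⟨N, hiN, hN, hNmax⟩ := exists_maximal_isEssentialIn.{w} i
  obtain ⟨K, hK, hKmax⟩ := exists_maximal_mono_comp.{w} (cokernel.π N.arrow)
  let π := cokernel.π K.arrow
  have hNπ : Mono (N.arrow ≫ π) := by
    refine Preadditive.mono_of_cancel_zero _ fun t ht => ?_
    rw [← Category.assoc] at ht
    let y := (ShortComplex.exact_of_g_is_cokernel
      (ShortComplex.mk K.arrow π (cokernel.condition _)) (cokernelIsCokernel _)).lift _ ht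
    have hy : y ≫ K.arrow = t ≫ N.arrow := ShortComplex.Exact.lift_f _ _ _
    have : y = 0 := by
      rw [← cancel_mono (K.arrow ≫ cokernel.π N.arrow), ← Category.assoc, hy]
      simp
    rw [← cancel_mono N.arrow, ← hy, this, zero_comp, zero_comp]
  have hess : ∀ ⦃W : C⦄ (g : cokernel K.arrow ⟶ W), Mono (N.arrow ≫ π ≫ g) → Mono g := by
    intro W g hg
    let K' := Subobject.mk (kernel.ι (π ≫ g))
    have hKK' : K ≤ K' := Subobject.le_mk_of_comm
      (kernel.lift _ K.arrow (by rw [← Category.assoc, cokernel.condition, zero_comp])) (by simp)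
    have hK' : Mono (K'.arrow ≫ cokernel.π N.arrow) := by
      refine Preadditive.mono_of_cancel_zero _ fun t ht => ?_
      rw [← Category.assoc] at ht
      let y := (ShortComplex.exact_of_g_is_cokernel
        (ShortComplex.mk N.arrow _ (cokernel.condition _)) (cokernelIsCokernel _)).lift _ ht
      have hy : y ≫ N.arrow = t ≫ K'.arrow := ShortComplex.Exact.lift_f _ _ _
      have hK'0 : K'.arrow ≫ π ≫ g = 0 := by
        rw [← cancel_epi (Subobject.underlyingIso (kernel.ι (π ≫ g))).inv, comp_zero,
          ← Category.assoc, Subobject.underlyingIso_arrow, kernel.condition]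
      have : y = 0 := by
        rw [← cancel_mono (N.arrow ≫ π ≫ g), ← Category.assoc, hy, Category.assoc, hK'0]
        simp
      rw [← cancel_mono K'.arrow, ← hy, this, zero_comp, zero_comp]
    have hle : K' ≤ K := hKmax hK' hKK'
    refine Preadditive.mono_of_cancel_zero _ fun {T} t ht => ?_
    obtain ⟨T', p, hp, x, hx⟩ := surjective_up_to_refinements_of_epi π t
    have h0 : x ≫ π ≫ g = 0 := by rw [← Category.assoc, ← hx, Category.assoc, ht, comp_zero]
    have h1 : K.Factors x := Subobject.factors_of_le x hle
      ((Subobject.mk_factors_iff _ _).2 ⟨kernel.lift _ x h0, by simp⟩)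
    rw [← cancel_epi p, hx, ← Subobject.factorThru_arrow _ _ h1, Category.assoc,
      cokernel.condition, comp_zero, comp_zero]
  let h : cokernel K.arrow ⟶ I := Injective.factorThru N.arrow (N.arrow ≫ π)
  have hh : (N.arrow ≫ π) ≫ h = N.arrow := Injective.comp_factorThru _ _
  have hmono : Mono h := hess h (by rw [← Category.assoc, hh]; infer_instance)
  have hmk : IsEssentialIn i (Subobject.mk h) := by
    intro W g hg
    have h1 := hN g hg
    have h2 : Mono (h ≫ g) := hess _ (by
      rw [← Category.assoc, ← Category.assoc, hh]
      exact h1)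
    rw [← Subobject.underlyingIso_hom_comp_eq_mk, Category.assoc]
    infer_instance
  have hle : Subobject.mk h ≤ N := hNmax hmk (Subobject.le_mk_of_comm _ hh)
  have hinj : Injective (N : C) := by
    refine Retract.injective (Y := I) ⟨N.arrow, π ≫ Subobject.ofMkLE h N hle, ?_⟩
    rw [← cancel_mono N.arrow]
    simpa using hh
  refine ⟨N, Subobject.ofMkLE i N hiN, inferInstance, hinj, fun Z g hg => ?_⟩
  -- `hN` only speaks of maps out of `I`, so `g` is pushed out along `N.arrow`.
  have h1 : Mono (N.arrow ≫ pushout.inl N.arrow g) := hN _ (by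
    have : i ≫ pushout.inl N.arrow g = (Subobject.ofMkLE i N hiN ≫ g) ≫ pushout.inr _ _ := by
      rw [Category.assoc, ← pushout.condition, ← Category.assoc, Subobject.ofMkLE_arrow]
    rw [this]
    infer_instance)
  rw [pushout.condition] at h1
  exact mono_of_mono g (pushout.inr N.arrow g)
end Grothendieck

/-! ### Multiplicities of a simple object as a length function -/

section Multiplicity

variable {C : Type u} [Category.{v} C] [Abelian C]

/-- `HasFactors S n M` means that `M` has a chain of subobjects with at least `n` factors isomorphic
to the simple object `S`. -/
def HasFactors (S : C) : ℕ → C → Prop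
  | 0, _ => True
  | n + 1, M => ∃ (B : C) (i : B ⟶ M) (p : B ⟶ S), Mono i ∧ p ≠ 0 ∧ HasFactors S n (kernel p)

namespace HasFactors

variable {S : C}

lemma of_mono {n : ℕ} {M N : C} (h : HasFactors S n M) (f : M ⟶ N) [Mono f] :
    HasFactors S n N := by
  cases n with
  | zero => trivial
  | succ n =>
    obtain ⟨B, i, p, hi, hp, h⟩ := h
    exact ⟨B, i ≫ f, p, inferInstance, hp, h⟩

/-- The chain in `M₃` is pulled back to `M₂` and continued below by the chain in `M₁`. -/
lemma add {m n : ℕ} {M₁ M₂ M₃ : C} (f : M₁ ⟶ M₂) (g : M₂ ⟶ M₃) [Mono f] [Epi g] (w : f ≫ g = 0)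
    (h₁ : HasFactors S m M₁) (h₃ : HasFactors S n M₃) : HasFactors S (m + n) M₂ := by
  induction n generalizing M₂ M₃ with
  | zero => exact h₁.of_mono f
  | succ n ih =>
    obtain ⟨B, i, p, hi, hp, h⟩ := h₃
    refine ⟨pullback g i, pullback.fst g i, pullback.snd g i ≫ p, inferInstance, fun h0 => hp ?_, ?_⟩
    · rw [← cancel_epi (pullback.snd g i), h0, comp_zero]
    · obtain ⟨l, hl₁, hl₂⟩ : ∃ l : M₁ ⟶ pullback g i,
          l ≫ pullback.fst g i = f ∧ l ≫ pullback.snd g i = 0 :=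
        ⟨pullback.lift f 0 (by simp [w]), pullback.lift_fst _ _ _, pullback.lift_snd _ _ _⟩
      let f' : M₁ ⟶ kernel (pullback.snd g i ≫ p) :=
        kernel.lift _ l (by rw [← Category.assoc, hl₂, zero_comp])
      have hf' : f' ≫ kernel.ι _ ≫ pullback.fst g i = f := by simp [f', hl₁]
      let g' : kernel (pullback.snd g i ≫ p) ⟶ kernel p :=
        kernel.lift _ (kernel.ι _ ≫ pullback.snd g i) (by simp)
      have : Mono f' := mono_of_mono_fac hf'
      have : Epi g' := by
        rw [epi_iff_surjective_up_to_refinements]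
        intro A y
        obtain ⟨A', q, hq, x, hx⟩ :=
          surjective_up_to_refinements_of_epi (pullback.snd g i) (y ≫ kernel.ι p)
        refine ⟨A', q, hq, kernel.lift _ x ?_, ?_⟩
        · rw [← Category.assoc, ← hx]
          simp
        · rw [← cancel_mono (kernel.ι p)]
          simp [g', hx]
      exact ih f' g' (by rw [← cancel_mono (kernel.ι p)]; simp [f', g', hl₂]) h

/-- Let `p : B ⟶ S` be the top factor. If `p` vanishes on the kernel of B → N, it descends to the
image of `B` and counts for `N`; otherwise its restriction to that kernel is nonzero and counts for
`kernel g`. -/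
lemma exists_add_eq [Simple S] {n : ℕ} {M N : C} (g : M ⟶ N) (h : HasFactors S n M) :
    ∃ a b, a + b = n ∧ HasFactors S a (kernel g) ∧ HasFactors S b N := by
  induction n generalizing M N with
  | zero => exact ⟨0, 0, rfl, trivial, trivial⟩
  | succ n ih =>
    obtain ⟨B, i, p, hi, hp, h⟩ := h
    let κ : kernel (i ≫ g) ⟶ kernel g := kernel.lift _ (kernel.ι _ ≫ i) (by simp)
    have hκ : κ ≫ kernel.ι g = kernel.ι _ ≫ i := kernel.lift_ι _ _ _
    have : Mono κ := by
      have : Mono (κ ≫ kernel.ι g) := by rw [hκ]; infer_instance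
      exact mono_of_mono κ (kernel.ι g)
    by_cases h0 : kernel.ι (i ≫ g) ≫ p = 0
    · obtain ⟨I, e, m, _, _, hem⟩ : ∃ (I : C) (e : B ⟶ I) (m : I ⟶ N), Epi e ∧ Mono m ∧
          e ≫ m = i ≫ g :=
        ⟨_, factorThruImage (i ≫ g), image.ι _, inferInstance, inferInstance, image.fac _⟩
      have hep : kernel.ι e ≫ p = 0 := by
        have : kernel.ι e = kernel.lift (i ≫ g) (kernel.ι e)
            (by rw [← hem, kernel.condition_assoc, zero_comp]) ≫ kernel.ι (i ≫ g) := by simp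
        rw [this, Category.assoc, h0, comp_zero]
      let p' := Abelian.epiDesc e p hep
      have hp' : e ≫ p' = p := Abelian.comp_epiDesc e p hep
      let k : kernel p ⟶ kernel p' := kernel.lift _ (kernel.ι p ≫ e) (by simp [hp'])
      have hk : k ≫ kernel.ι p' = kernel.ι p ≫ e := kernel.lift_ι _ _ _
      obtain ⟨a, b, hab, ha, hb⟩ := ih k h
      refine ⟨a, b + 1, by omega, ?_, ⟨I, m, p', inferInstance, ?_, hb⟩⟩
      · let t : kernel k ⟶ kernel g := kernel.lift _ (kernel.ι k ≫ kernel.ι p ≫ i) (by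
          have h1 : kernel.ι p ≫ i ≫ g = k ≫ kernel.ι p' ≫ m := by
            rw [← Category.assoc k, hk, Category.assoc, hem]
          simp only [Category.assoc, h1]
          simp)
        have ht : t ≫ kernel.ι g = kernel.ι k ≫ kernel.ι p ≫ i := kernel.lift_ι _ _ _
        have : Mono t := by
          have : Mono (t ≫ kernel.ι g) := by rw [ht]; infer_instance
          exact mono_of_mono t (kernel.ι g)
        exact ha.of_mono t
      · intro h0'
        exact hp (by rw [← hp', h0', comp_zero])
    · obtain ⟨a, b, hab, ha, hb⟩ := ih (kernel.ι p ≫ i ≫ g) h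
      refine ⟨a + 1, b, by omega, ⟨kernel (i ≫ g), κ, kernel.ι (i ≫ g) ≫ p, inferInstance, h0, ?_⟩,
        hb⟩
      let t : kernel (kernel.ι p ≫ i ≫ g) ⟶ kernel (kernel.ι (i ≫ g) ≫ p) :=
        kernel.lift _ (kernel.lift _ (kernel.ι _ ≫ kernel.ι p) (by simp)) (by simp)
      have ht : t ≫ kernel.ι _ ≫ kernel.ι (i ≫ g) = kernel.ι _ ≫ kernel.ι p := by simp [t]
      have : Mono t := by
        have : Mono (t ≫ kernel.ι _ ≫ kernel.ι (i ≫ g)) := by rw [ht]; infer_instance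
        exact mono_of_mono t (kernel.ι _ ≫ kernel.ι (i ≫ g))
      exact ha.of_mono t

/-- A chain of subobjects of `M` restricts to a member of a directed family covering `M`. -/
lemma exists_of_isLUB [IsGrothendieckAbelian.{w} C] {n : ℕ} {M A : C} (a : A ⟶ M) [Mono a]
    {s : Set (Subobject M)} (hs : s.Nonempty) (hd : DirectedOn (· ≤ ·) s) (hU : IsLUB s ⊤)
    (h : HasFactors S n A) : ∃ Y ∈ s, HasFactors S n (pullback a Y.arrow) := by
  induction n generalizing A with
  | zero => exact ⟨hs.some, hs.some_mem, trivial⟩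
  | succ n ih =>
    obtain ⟨B, i, p, hi, hp, h⟩ := h
    -- `Y₁` keeps the chain in `kernel p`, `Y₂` keeps `p` nonzero on the intersection; a common
    -- upper bound does both.
    obtain ⟨Y₁, hY₁, h₁⟩ := ih (kernel.ι p ≫ i ≫ a) h
    obtain ⟨Y₂, hY₂, h₂⟩ : ∃ Y ∈ s, pullback.fst (i ≫ a) Y.arrow ≫ p ≠ 0 := by
      by_contra! hc
      exact hp (eq_zero_of_pullback_fst_comp_eq_zero.{w} hs hd hU (i ≫ a) p hc)
    obtain ⟨Y, hY, h₁Y, h₂Y⟩ := hd Y₁ hY₁ Y₂ hY₂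
    have hw := pullback.condition (f := i ≫ a) (g := Y.arrow)
    refine ⟨Y, hY, pullback (i ≫ a) Y.arrow, pullback.lift (pullback.fst _ _ ≫ i) (pullback.snd _ _)
      (by rw [← hw, Category.assoc]), pullback.fst _ _ ≫ p, ?_, fun h0 => h₂ ?_, ?_⟩
    · refine mono_of_mono_fac (h := pullback.fst _ _ ≫ i) (f := pullback.fst _ _)
        (pullback.lift_fst _ _ _)
    · have : pullback.fst (i ≫ a) Y₂.arrow = pullback.lift (pullback.fst _ _)
        (pullback.snd _ _ ≫ Subobject.ofLE _ _ h₂Y) (by simp [← pullback.condition]) ≫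
          pullback.fst (i ≫ a) Y.arrow := (pullback.lift_fst _ _ _).symm
      rw [this, Category.assoc, h0, comp_zero]
    · obtain ⟨l, hl⟩ : ∃ l : pullback (kernel.ι p ≫ i ≫ a) Y₁.arrow ⟶ pullback (i ≫ a) Y.arrow,
          l ≫ pullback.fst (i ≫ a) Y.arrow = pullback.fst _ _ ≫ kernel.ι p :=
        ⟨pullback.lift (pullback.fst _ _ ≫ kernel.ι p)
          (pullback.snd _ _ ≫ Subobject.ofLE _ _ h₁Y) (by simp [← pullback.condition]),
          pullback.lift_fst _ _ _⟩
      let t : pullback (kernel.ι p ≫ i ≫ a) Y₁.arrow ⟶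
          kernel (pullback.fst (i ≫ a) Y.arrow ≫ p) :=
        kernel.lift _ l (by
          rw [← Category.assoc l, hl, Category.assoc, kernel.condition, comp_zero])
      have ht : t ≫ kernel.ι _ ≫ pullback.fst (i ≫ a) Y.arrow = pullback.fst _ _ ≫ kernel.ι p := by
        simp [t, hl]
      have : Mono t := by
        have : Mono (t ≫ kernel.ι _ ≫ pullback.fst (i ≫ a) Y.arrow) := by rw [ht]; infer_instance
        exact mono_of_mono t (kernel.ι _ ≫ pullback.fst (i ≫ a) Y.arrow)
      exact h₁.of_mono t

end HasFactors

/-- The multiplicity of the simple object `S` in `M`. -/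
noncomputable def multiplicity (S M : C) : ℝ≥0∞ := ⨆ n : {n : ℕ // HasFactors S n M}, (n.1 : ℝ≥0∞)

lemma le_multiplicity {S M : C} {n : ℕ} (h : HasFactors S n M) : (n : ℝ≥0∞) ≤ multiplicity S M :=
  le_iSup (fun n : {n : ℕ // HasFactors S n M} => (n.1 : ℝ≥0∞)) ⟨n, h⟩

lemma multiplicity_le_iff {S M : C} {x : ℝ≥0∞} :
    multiplicity S M ≤ x ↔ ∀ n, HasFactors S n M → (n : ℝ≥0∞) ≤ x := by
  simp [multiplicity]

lemma multiplicity_le_of_mono {S M N : C} (f : M ⟶ N) [Mono f] :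
    multiplicity S M ≤ multiplicity S N :=
  multiplicity_le_iff.2 fun _ h => le_multiplicity (h.of_mono f)

lemma isLengthFunction_multiplicity [IsGrothendieckAbelian.{w} C] (S : C) [Simple S] :
    IsLengthFunction (multiplicity S) where
  iso_invariant X Y := fun ⟨e⟩ =>
    le_antisymm (multiplicity_le_of_mono e.hom) (multiplicity_le_of_mono e.inv)
  zero X hX := by
    refine le_antisymm (multiplicity_le_iff.2 fun n h => ?_) bot_le
    cases n with
    | zero => simp
    | succ n =>
      obtain ⟨B, i, p, hi, hp, h⟩ := h
      exact (hp ((hX.of_mono i).eq_of_src _ _)).elim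
  additive X hX := by
    have := hX.mono_f
    have := hX.epi_g
    apply le_antisymm
    · refine multiplicity_le_iff.2 fun n h => ?_
      obtain ⟨a, b, rfl, ha, hb⟩ := h.exists_add_eq X.g
      push_cast
      refine add_le_add (le_multiplicity ?_) (le_multiplicity hb)
      exact ha.of_mono (IsLimit.conePointUniqueUpToIso (kernelIsKernel X.g) hX.fIsKernel).hom
    · unfold multiplicity
      have : Nonempty {n : ℕ // HasFactors S n X.X₁} := ⟨0, trivial⟩
      have : Nonempty {n : ℕ // HasFactors S n X.X₃} := ⟨0, trivial⟩
      refine ENNReal.iSup_add_iSup_le fun a b => ?_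
      exact_mod_cast le_multiplicity (HasFactors.add X.f X.g X.zero a.2 b.2)
  upper_continuous X s hs hd hU := by
    apply le_antisymm
    · refine multiplicity_le_iff.2 fun n h => ?_
      obtain ⟨Y, hY, h⟩ := h.exists_of_isLUB.{w} (𝟙 X) hs hd hU
      exact (le_multiplicity (h.of_mono (pullback.snd _ _))).trans
        (le_iSup₂ (f := fun Y (_ : Y ∈ s) => multiplicity S (Y : C)) Y hY)
    · exact iSup₂_le fun Y _ => multiplicity_le_of_mono Y.arrow

lemma isIso_of_mono_of_ne_zero_comp {B T S : C} [Simple T] (i : B ⟶ T) [Mono i] (p : B ⟶ S)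
    (hp : p ≠ 0) : IsIso i := by
  refine isIso_of_mono_of_nonzero fun h => hp ?_
  have : IsZero B := by
    rw [IsZero.iff_id_eq_zero, ← cancel_mono i, h, comp_zero, comp_zero]
  exact this.eq_of_src _ _

lemma multiplicity_self (S : C) [Simple S] : multiplicity S S = 1 := by
  apply le_antisymm
  · refine multiplicity_le_iff.2 fun n h => ?_
    match n, h with
    | 0, _ => simp
    | 1, _ => simp
    | n + 2, ⟨B, i, p, hi, hp, B', i', p', hi', hp', h⟩ =>
      have := isIso_of_mono_of_ne_zero_comp i p hp
      have : Mono p := by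
        rw [← IsIso.hom_inv_id_assoc i p]
        have := isIso_of_hom_simple (f := inv i ≫ p) (fun h0 => hp (by
          rw [← IsIso.hom_inv_id_assoc i p, h0, comp_zero]))
        infer_instance
      exact (hp' (((isZero_kernel_of_mono p).of_mono i').eq_of_src _ _)).elim
  · have : HasFactors S 1 S := ⟨S, 𝟙 S, 𝟙 S, inferInstance, id_nonzero S, trivial⟩
    exact_mod_cast le_multiplicity this

lemma multiplicity_eq_zero {S T : C} [Simple S] [Simple T] (h : IsEmpty (S ≅ T)) :
    multiplicity S T = 0 := by
  refine le_antisymm (multiplicity_le_iff.2 fun n hn => ?_) bot_le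
  match n, hn with
  | 0, _ => simp
  | n + 1, ⟨B, i, p, hi, hp, hn⟩ =>
    have := isIso_of_mono_of_ne_zero_comp i p hp
    have := isIso_of_hom_simple (f := inv i ≫ p) (fun h0 => hp (by
      rw [← IsIso.hom_inv_id_assoc i p, h0, comp_zero]))
    exact (h.false (asIso (inv i ≫ p)).symm).elim

end Multiplicity

/-! ### Composition length by descending chains -/

section CompositionLength

/-- `HasLength n X` means that `X` has a chain of subobjects of length at least `n`. -/
def HasLength {D : Type*} [Category* D] : ℕ → D → Prop
  | 0, _ => True
  | n + 1, X => ∃ (Y : D) (i : Y ⟶ X), Mono i ∧ ¬ IsIso i ∧ HasLength n Y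

variable {D : Type*} [Category* D]

lemma hasLength_of_ltSeries {X : D} (n : ℕ) (σ : LTSeries (Subobject X)) (hσ : σ.length = n) :
    HasLength n (σ.last : D) := by
  induction n generalizing σ with
  | zero => trivial
  | succ n ih =>
    have hlt : σ.eraseLast.last < σ.last := σ.eraseLast_last_rel_last (by omega)
    refine ⟨_, Subobject.ofLE _ _ hlt.le, inferInstance, fun h => hlt.not_ge ?_,
      ih σ.eraseLast (by simp [hσ])⟩
    exact Subobject.le_of_comm (inv (Subobject.ofLE _ _ hlt.le)) (by
      rw [IsIso.inv_comp_eq, Subobject.ofLE_arrow])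

lemma HasLength.exists_ltSeries [HasZeroMorphisms D] [HasZeroObject D] {X Y : D} (f : Y ⟶ X)
    [Mono f] {n : ℕ} (h : HasLength n Y) :
    ∃ σ : LTSeries (Subobject X), σ.head = ⊥ ∧ σ.last = Subobject.mk f ∧ n ≤ σ.length := by
  induction n generalizing Y with
  | zero =>
    -- The chains of `HasLength` may stop above ⊥. Adding ⊥ can lengthen them, hence only `n ≤
    -- σ.length`.
    rcases eq_bot_or_bot_lt (Subobject.mk f) with h0 | h0
    · exact ⟨RelSeries.singleton _ ⊥, rfl, h0.symm, le_rfl⟩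
    · exact ⟨(RelSeries.singleton _ ⊥).snoc (Subobject.mk f) h0, RelSeries.head_snoc _ _ _,
        RelSeries.last_snoc _ _ _, by simp⟩
  | succ n ih =>
    obtain ⟨Z, i, hi, hni, h⟩ := h
    obtain ⟨σ, h₁, h₂, h₃⟩ := ih (i ≫ f) h
    have hlt : Subobject.mk (i ≫ f) < Subobject.mk f := by
      refine lt_of_le_not_ge (Subobject.mk_le_mk_of_comm i rfl) fun hle => hni ?_
      have : Subobject.ofMkLEMk _ _ hle ≫ i = 𝟙 _ := by
        rw [← cancel_mono f, Category.assoc, Subobject.ofMkLEMk_comp, Category.id_comp]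
      have : IsSplitEpi i := ⟨⟨⟨_, this⟩⟩⟩
      exact isIso_of_mono_of_isSplitEpi i
    exact ⟨σ.snoc _ (h₂ ▸ hlt), by simpa using h₁, by simp, by simpa using h₃⟩

lemma HasLength.of_iso {X Y : D} (e : X ≅ Y) {n : ℕ} (h : HasLength n X) : HasLength n Y := by
  cases n with
  | zero => trivial
  | succ n =>
    obtain ⟨Z, i, hi, hni, h⟩ := h
    refine ⟨Z, i ≫ e.hom, inferInstance, fun hh => hni ?_, h⟩
    exact IsIso.of_isIso_comp_right i e.hom

lemma compositionLength_le_iff [HasZeroMorphisms D] [HasZeroObject D] {X : D} {x : ℝ≥0∞} :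
    compositionLength X ≤ x ↔ ∀ n, HasLength n X → (n : ℝ≥0∞) ≤ x := by
  constructor
  · intro h n hn
    obtain ⟨σ, h₁, h₂, h₃⟩ := hn.exists_ltSeries (𝟙 X)
    refine le_trans ?_ ((le_iSup (fun σ : {σ : LTSeries (Subobject X) // IsBot σ.head ∧ IsTop σ.last}
      => (σ.1.length : ℝ≥0∞)) ⟨σ, ?_, ?_⟩).trans h)
    · exact_mod_cast h₃
    · rw [h₁]
      exact isBot_bot
    · rw [h₂, ← Subobject.top_eq_id]
      exact isTop_top
  · intro h
    refine iSup_le fun ⟨σ, _, hσ⟩ => h _ ?_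
    have := hasLength_of_ltSeries _ σ rfl
    rw [hσ.isMax.eq_top] at this
    exact this.of_iso (asIso (⊤ : Subobject X).arrow)

end CompositionLength

/-! ### Atomic lengths as multiplicities -/

section Localization

variable {C : Type u} [Category.{v} C] [Abelian C]

/-- Write the subobject as a right fraction and replace its numerator by its image: the epi onto the
image becomes both mono and epi, hence invertible, after localization. -/
lemma exists_mono_of_mono_localization (P : ObjectProperty C) [P.IsSerreClass] {M : C}
    {Y : P.isoModSerre.Localization} (j : Y ⟶ P.isoModSerre.Q.obj M) [Mono j] :
    ∃ (N : C) (n : N ⟶ M) (e : P.isoModSerre.Q.obj N ≅ Y), Mono n ∧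
      e.hom ≫ j = P.isoModSerre.Q.map n := by
  let L := P.isoModSerre.Q
  let := ObjectProperty.SerreClassLocalization.abelian L P
  have := Localization.essSurj L P.isoModSerre
  let e₀ := L.objObjPreimageIso Y
  obtain ⟨φ, hφ⟩ := Localization.exists_rightFraction L P.isoModSerre (e₀.hom ≫ j)
  have hs : IsIso (L.map φ.s) := Localization.inverts L P.isoModSerre φ.s φ.hs
  have hφ' : L.map φ.f = (asIso (L.map φ.s) ≪≫ e₀).hom ≫ j := by
    simp [hφ, MorphismProperty.RightFraction.map_s_comp_map]
  have : Mono (L.map φ.f) := by rw [hφ']; infer_instance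
  have : L.PreservesEpimorphisms :=
    ObjectProperty.SerreClassLocalization.preservesEpimorphisms L P
  have hfac : L.map (factorThruImage φ.f) ≫ L.map (image.ι φ.f) = L.map φ.f := by
    rw [← L.map_comp, image.fac]
  have : Mono (L.map (factorThruImage φ.f)) := mono_of_mono_fac hfac
  have : IsIso (L.map (factorThruImage φ.f)) := isIso_of_mono_of_epi _
  refine ⟨_, image.ι φ.f, (asIso (L.map (factorThruImage φ.f))).symm ≪≫
    asIso (L.map φ.s) ≪≫ e₀, inferInstance, ?_⟩
  rw [Iso.trans_hom, Category.assoc, ← hφ', ← hfac]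
  simp [L]

variable {S : C}

/-- `torsionClass` quantifies over all injective envelopes of `S`, so the existence of one is
essential here. -/
lemma not_torsionClass_self [IsGrothendieckAbelian.{w} C] [Simple S] : ¬ torsionClass S S := by
  intro h
  obtain ⟨E, i, hi⟩ := exists_isInjectiveEnvelope.{w} S
  have := hi.mono
  exact Simple.not_isZero S (IsZero.of_mono_eq_zero i (h i hi i))

/-- An object which is not a torsion object for `S` has `S` as a subquotient. -/
lemma exists_ne_zero_of_not_torsionClass [Simple S] {N M : C} (n : N ⟶ M)
    (h : ¬ torsionClass S (cokernel n)) :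
    ∃ (B : C) (b : B ⟶ M) (p : B ⟶ S) (k : N ⟶ B), Mono b ∧ p ≠ 0 ∧ k ≫ b = n ∧ k ≫ p = 0 := by
  simp only [torsionClass, not_forall] at h
  obtain ⟨E, i, hi, f, hf⟩ := h
  have := hi.mono
  let f' := cokernel.π n ≫ f
  have hf' : f' ≠ 0 := fun h0 => hf (by rw [← cancel_epi (cokernel.π n), comp_zero]; exact h0)
  -- Since `i` is essential and `S` is simple, `S` lies in the image of `f'`; the object `B` sought
  -- is the preimage of `S`.
  have hi0 : i ≫ cokernel.π f' = 0 := by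
    by_contra hne
    have := hi.essential (cokernel.π f') (mono_of_nonzero_from_simple hne)
    exact hf' (by rw [← cancel_mono (cokernel.π f'), cokernel.condition, zero_comp])
  obtain ⟨A, q, hq, x, hx⟩ := (ShortComplex.exact_of_g_is_cokernel
    (ShortComplex.mk f' _ (cokernel.condition f'))
    (cokernelIsCokernel f')).exact_up_to_refinements i hi0
  refine ⟨pullback f' i, pullback.fst _ _, pullback.snd _ _, pullback.lift n 0 (by simp [f']),
    inferInstance, fun h0 => ?_, pullback.lift_fst _ _ _, pullback.lift_snd _ _ _⟩
  have h1 : q = 0 := by rw [← pullback.lift_snd x q hx.symm, h0, comp_zero]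
  apply Simple.not_isZero S
  rw [IsZero.iff_id_eq_zero, ← cancel_epi q, h1, zero_comp, zero_comp]

lemma not_isoModSerre_kernel_ι [IsGrothendieckAbelian.{w} C] [Simple S] {B : C} (p : B ⟶ S)
    (hp : p ≠ 0) : ¬ (torsionClass S).isoModSerre (kernel.ι p) := by
  intro h
  have hc : torsionClass S (cokernel (kernel.ι p)) := h.2
  have : Epi p := epi_of_nonzero_to_simple hp
  have : Epi (cokernel.desc (kernel.ι p) p (kernel.condition p)) :=
    epi_of_epi_fac (cokernel.π_desc (kernel.ι p) p (kernel.condition p))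
  exact not_torsionClass_self.{w}
    ((torsionClass S).prop_of_epi (cokernel.desc (kernel.ι p) p (kernel.condition p)) hc)

/-- A proper subobject lifts to some N ⊆ M with M/N not torsion, so some B ⊆ M has a nonzero map to
`S` whose kernel contains N. Conversely, a factor `S` of `M` survives as a strict inclusion because
`S` is not torsion. -/
lemma hasLength_localization_iff [IsGrothendieckAbelian.{w} C] [Simple S] {n : ℕ} {M : C} :
    HasLength n ((torsionClass S).isoModSerre.Q.obj M) ↔ HasFactors S n M := by
  let P := torsionClass S
  let L := P.isoModSerre.Q
  have : L.PreservesMonomorphisms :=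
    ObjectProperty.SerreClassLocalization.preservesMonomorphisms L P
  induction n generalizing M with
  | zero => exact Iff.rfl
  | succ n ih =>
    constructor
    · rintro ⟨Y, j, hj, hnj, h⟩
      obtain ⟨N, m, e, hm, he⟩ := exists_mono_of_mono_localization P j
      have hN := ih.1 (h.of_iso e.symm)
      have hnot : ¬ P (cokernel m) := by
        intro hP
        have := (ObjectProperty.SerreClassLocalization.isIso_map_iff L P m).2
          (P.isoModSerre_of_mono m hP)
        apply hnj
        have h1 : IsIso (e.hom ≫ j) := by rw [he]; exact this
        exact IsIso.of_isIso_comp_left e.hom j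
      obtain ⟨B, b, p, k, hb, hp, hkb, hkp⟩ := exists_ne_zero_of_not_torsionClass m hnot
      have hfac : kernel.lift p k hkp ≫ kernel.ι p ≫ b = m := by simp [hkb]
      have : Mono (kernel.lift p k hkp) := mono_of_mono_fac hfac
      exact ⟨B, b, p, hb, hp, hN.of_mono (kernel.lift p k hkp)⟩
    · rintro ⟨B, i, p, hi, hp, h⟩
      refine ⟨L.obj (kernel p), L.map (kernel.ι p) ≫ L.map i, inferInstance, fun hiso => ?_,
        ih.2 h⟩
      have : IsSplitEpi (L.map i) := ⟨⟨⟨inv (L.map (kernel.ι p) ≫ L.map i) ≫ L.map (kernel.ι p),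
        by rw [Category.assoc, IsIso.inv_hom_id]⟩⟩⟩
      have : IsIso (L.map i) := isIso_of_mono_of_isSplitEpi _
      have := IsIso.of_isIso_comp_right (L.map (kernel.ι p)) (L.map i)
      exact not_isoModSerre_kernel_ι.{w} p hp
        ((ObjectProperty.SerreClassLocalization.isIso_map_iff L P _).1 this)

instance (π : Sp C) : Simple π.obj := (Quotient.out (s := simpleSetoid C) π).2

lemma atomicLength_eq_multiplicity [IsGrothendieckAbelian.{w} C] (π : Sp C) :
    atomicLength π = multiplicity π.obj := by
  funext M
  have := ObjectProperty.SerreClassLocalization.hasZeroObject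
    (torsionClass π.obj).isoModSerre.Q (torsionClass π.obj)
  refine eq_of_forall_ge_iff fun x => ?_
  rw [multiplicity_le_iff, atomicLength, compositionLength_le_iff]
  exact forall_congr' fun n => imp_congr_left hasLength_localization_iff.{w}

end Localization

/-! ### Objects on which two length functions agree -/

section Agreement

variable {C : Type u} [Category.{v} C]

/-- The objects on all of whose subquotients the functions `L` and `L'` agree. -/
def AgreeOn (L L' : C → ℝ≥0∞) : ObjectProperty C := fun M =>
  ∀ ⦃B N : C⦄ (i : B ⟶ M) (p : B ⟶ N), Mono i → Epi p → L N = L' N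

lemma AgreeOn.eq {L L' : C → ℝ≥0∞} {M : C} (h : AgreeOn L L' M) : L M = L' M :=
  h (𝟙 M) (𝟙 M) inferInstance inferInstance

lemma AgreeOn.of_mono {L L' : C → ℝ≥0∞} {M N : C} (h : AgreeOn L L' N) (f : M ⟶ N)
    [Mono f] : AgreeOn L L' M :=
  fun _ _ i p _ hp => h (i ≫ f) p inferInstance hp

end Agreement

/-! ### Determination by the values on simple objects -/

section Uniqueness

variable {C : Type u} [Category.{v} C] [Abelian C]

namespace IsLengthFunction

lemma mono {L : C → ℝ≥0∞} (hL : IsLengthFunction L) {M N : C} (f : M ⟶ N) [Mono f] : L M ≤ L N := by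
  have hS : (ShortComplex.mk f (cokernel.π f) (cokernel.condition f)).ShortExact :=
    { exact := ShortComplex.exact_of_g_is_cokernel _ (cokernelIsCokernel f) }
  rw [hL.additive hS]
  exact le_self_add

lemma tsum_mul {ι : Type*} (c : ι → ℝ≥0∞) {l : ι → C → ℝ≥0∞}
    (hl : ∀ i, IsLengthFunction (l i)) : IsLengthFunction fun M => ∑' i, c i * l i M where
  iso_invariant X Y h := tsum_congr fun i => by rw [(hl i).iso_invariant h]
  zero X hX := by simp [(hl _).zero hX]
  additive S hS := by
    rw [← ENNReal.tsum_add]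
    exact tsum_congr fun i => by rw [(hl i).additive hS, mul_add]
  upper_continuous X s hs hd hU := by
    have hmono (i : ι) {Y Z : Subobject X} (h : Y ≤ Z) : l i Y ≤ l i Z :=
      (hl i).mono (Subobject.ofLE Y Z h)
    simp only [(hl _).upper_continuous s hs hd hU, iSup_subtype', ENNReal.mul_iSup,
      ENNReal.tsum_eq_iSup_sum]
    rw [iSup_comm]
    -- Finite sums commute with suprema of monotone directed families.
    refine iSup_congr fun t => ENNReal.finsetSum_iSup fun Y Z => ?_
    obtain ⟨W, hW, hYW, hZW⟩ := hd _ Y.2 _ Z.2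
    exact ⟨⟨W, hW⟩, fun i => ⟨mul_le_mul_right (hmono i hYW) _, mul_le_mul_right (hmono i hZW) _⟩⟩

end IsLengthFunction

variable {L L' : C → ℝ≥0∞}

lemma AgreeOn.of_epi {M N : C} (h : AgreeOn L L' M) (f : M ⟶ N) [Epi f] : AgreeOn L L' N :=
  fun _ _ i p _ _ => h (pullback.fst f i) (pullback.snd f i ≫ p) inferInstance inferInstance

lemma agreeOn_of_isZero (hL : IsLengthFunction L) (hL' : IsLengthFunction L') {M : C}
    (hM : IsZero M) : AgreeOn L L' M := fun B N i p _ _ => by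
  have : IsZero N := (hM.of_mono i).of_epi p
  rw [hL.zero this, hL'.zero this]

/-- A quotient `Q` of B ⊆ M is an extension of a quotient of the image of `B` in `N` by `K`, the
image in `Q` of B ∩ ker g. Additivity then gives the value at `Q`. -/
lemma AgreeOn.of_kernel (hL : IsLengthFunction L) (hL' : IsLengthFunction L') {M N : C}
    (g : M ⟶ N) (h₁ : AgreeOn L L' (kernel g)) (h₃ : AgreeOn L L' N) : AgreeOn L L' M := by
  intro B Q i p _ _
  let κ := kernel.ι (i ≫ g)
  obtain ⟨K, a, b, _, _, hab⟩ : ∃ (K : C) (a : kernel (i ≫ g) ⟶ K) (b : K ⟶ Q), Epi a ∧ Mono b ∧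
      a ≫ b = κ ≫ p :=
    ⟨_, factorThruImage (κ ≫ p), image.ι _, inferInstance, inferInstance, image.fac _⟩
  have hκ : Mono (kernel.lift g (κ ≫ i) (by simp [κ])) :=
    mono_of_mono_fac (kernel.lift_ι g (κ ≫ i) (by simp [κ]))
  have e₁ : L K = L' K := h₁ (kernel.lift g (κ ≫ i) (by simp [κ])) a hκ inferInstance
  let q := cokernel.π b
  obtain ⟨I, e, m, _, _, hem⟩ : ∃ (I : C) (e : B ⟶ I) (m : I ⟶ N), Epi e ∧ Mono m ∧
      e ≫ m = i ≫ g :=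
    ⟨_, factorThruImage (i ≫ g), image.ι _, inferInstance, inferInstance, image.fac _⟩
  have hκq : κ ≫ p ≫ q = 0 := by
    rw [← Category.assoc, ← hab, Category.assoc, cokernel.condition, comp_zero]
  have he : kernel.ι e ≫ p ≫ q = 0 := by
    have : kernel.ι e = kernel.lift (i ≫ g) (kernel.ι e)
      (by rw [← hem, kernel.condition_assoc, zero_comp]) ≫ κ := by simp [κ]
    rw [this, Category.assoc, hκq, comp_zero]
  have hr : Epi (Abelian.epiDesc e (p ≫ q) he) := by
    have : Epi (e ≫ Abelian.epiDesc e (p ≫ q) he) := by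
      rw [Abelian.comp_epiDesc]
      infer_instance
    exact epi_of_epi e _
  have e₃ : L (cokernel b) = L' (cokernel b) :=
    (h₃.of_mono m).of_epi (Abelian.epiDesc e (p ≫ q) he) |>.eq
  have hS : (ShortComplex.mk b q (cokernel.condition _)).ShortExact :=
    { exact := ShortComplex.exact_of_g_is_cokernel _ (cokernelIsCokernel _) }
  rw [hL.additive hS, hL'.additive hS]
  exact congrArg₂ _ e₁ e₃

lemma AgreeOn.biprod (hL : IsLengthFunction L) (hL' : IsLengthFunction L') {M N : C}
    (hM : AgreeOn L L' M) (hN : AgreeOn L L' N) : AgreeOn L L' (M ⊞ N) := by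
  have : Mono (kernel.ι (biprod.snd : M ⊞ N ⟶ N) ≫ biprod.fst) := by
    refine Preadditive.mono_of_cancel_zero _ fun t ht => ?_
    rw [← cancel_mono (kernel.ι (biprod.snd : M ⊞ N ⟶ N))]
    apply biprod.hom_ext <;> simp [ht]
  exact .of_kernel hL hL' biprod.snd
    (hM.of_mono (kernel.ι (biprod.snd : M ⊞ N ⟶ N) ≫ biprod.fst)) hN

/-- A quotient `N` of B ⊆ M is the directed join of the images of the B ∩ Y, which are subquotients
of the members `Y`; upper continuity concludes. -/
lemma agreeOn_of_isLUB [IsGrothendieckAbelian.{w} C] (hL : IsLengthFunction L)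
    (hL' : IsLengthFunction L') {M : C} {s : Set (Subobject M)} (hs : s.Nonempty)
    (hd : DirectedOn (· ≤ ·) s) (hU : IsLUB s ⊤) (h : ∀ Y ∈ s, AgreeOn L L' (Y : C)) :
    AgreeOn L L' M := by
  intro B N i p _ _
  let F (Y : Subobject M) : Subobject N := imageSubobject (pullback.fst i Y.arrow ≫ p)
  have hF {Y Z : Subobject M} (hYZ : Y ≤ Z) : F Y ≤ F Z :=
    imageSubobject_le _ (pullback.lift (pullback.fst _ _) (pullback.snd _ _ ≫ Subobject.ofLE _ _ hYZ)
      (by simp [pullback.condition]) ≫ factorThruImageSubobject _) (by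
        rw [Category.assoc, imageSubobject_arrow_comp, pullback.lift_fst_assoc])
  have hd' : DirectedOn (· ≤ ·) (F '' s) := by
    rintro _ ⟨Y, hY, rfl⟩ _ ⟨Z, hZ, rfl⟩
    obtain ⟨W, hW, h₁, h₂⟩ := hd Y hY Z hZ
    exact ⟨_, ⟨W, hW, rfl⟩, hF h₁, hF h₂⟩
  have hU' : IsLUB (F '' s) ⊤ := by
    refine ⟨fun _ _ => le_top, fun V hV => ?_⟩
    have h0 : p ≫ cokernel.π V.arrow = 0 :=
      eq_zero_of_pullback_fst_comp_eq_zero.{w} hs hd hU i _ fun Y hY => by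
        rw [← Category.assoc, ← imageSubobject_arrow_comp (pullback.fst i Y.arrow ≫ p),
          ← Subobject.ofLE_arrow (hV ⟨Y, hY, rfl⟩), Category.assoc, Category.assoc,
          cokernel.condition, comp_zero, comp_zero]
    have : Epi V.arrow := by
      apply Preadditive.epi_of_cokernel_zero
      rw [← cancel_epi p, h0, comp_zero]
    exact ((Subobject.isIso_arrow_iff_eq_top V).1 (isIso_of_mono_of_epi _)).ge
  rw [hL.upper_continuous _ (hs.image F) hd' hU', hL'.upper_continuous _ (hs.image F) hd' hU']
  refine iSup_congr fun _ => iSup_congr fun hZ => ?_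
  obtain ⟨Y, hY, rfl⟩ := hZ
  exact h Y hY (pullback.snd i Y.arrow) (factorThruImageSubobject _) inferInstance inferInstance

lemma isHereditaryTorsionClass_agreeOn [IsGrothendieckAbelian.{w} C] (hL : IsLengthFunction L)
    (hL' : IsLengthFunction L') : IsHereditaryTorsionClass.{w} (AgreeOn L L') where
  isSerreClass :=
    { exists_zero := ⟨0, isZero_zero C, agreeOn_of_isZero hL hL' (isZero_zero C)⟩
      prop_of_mono f _ h := h.of_mono f
      prop_of_epi f _ h := h.of_epi f
      prop_X₂_of_shortExact {S} hS h₁ h₃ := AgreeOn.of_kernel hL hL' S.g (by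
        have := hS.mono_f
        exact h₁.of_epi (IsLimit.conePointUniqueUpToIso hS.fIsKernel (kernelIsKernel S.g)).hom) h₃ }
  coproducts J := ⟨by
    rintro M ⟨c⟩
    -- Sums of two members are quotients of their biproduct, so this set is directed; it contains
    -- the images of the summands, so its join is `M`.
    refine agreeOn_of_isLUB.{w} hL hL' (s := {Y : Subobject M | AgreeOn L L' (Y : C)}) ?_ ?_ ?_
      fun _ h => h
    · refine ⟨⊥, agreeOn_of_isZero hL hL' ?_⟩
      rw [IsZero.iff_id_eq_zero, ← cancel_mono (⊥ : Subobject M).arrow]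
      simp
    · intro Y hY Z hZ
      refine ⟨imageSubobject (biprod.desc Y.arrow Z.arrow), ?_, ?_, ?_⟩
      · exact (AgreeOn.biprod hL hL' hY hZ).of_epi (factorThruImageSubobject _)
      · exact Subobject.le_of_comm (biprod.inl ≫ factorThruImageSubobject _) (by simp)
      · exact Subobject.le_of_comm (biprod.inr ≫ factorThruImageSubobject _) (by simp)
    · refine ⟨fun _ _ => le_top, fun V hV => ?_⟩
      have : Epi V.arrow := by
        refine Preadditive.epi_of_cokernel_zero (c.isColimit.hom_ext fun j => ?_)
        have hj : AgreeOn L L' (imageSubobject (c.ι.app j) : C) :=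
          (c.prop_diag_obj j).of_epi (factorThruImageSubobject _)
        change c.ι.app j ≫ _ = c.ι.app j ≫ _
        rw [← imageSubobject_arrow_comp (c.ι.app j), ← Subobject.ofLE_arrow (hV hj)]
        simp only [Category.assoc, cokernel.condition, comp_zero]
      exact ((Subobject.isIso_arrow_iff_eq_top V).1 (isIso_of_mono_of_epi _)).ge⟩

lemma agreeOn_of_simple (hL : IsLengthFunction L) (hL' : IsLengthFunction L') {S : C} [Simple S]
    (h : L S = L' S) : AgreeOn L L' S := by
  intro B N i p _ _
  by_cases hp : p = 0
  · have : IsZero N := by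
      rw [IsZero.iff_id_eq_zero, ← cancel_epi p, hp, zero_comp, zero_comp]
    rw [hL.zero this, hL'.zero this]
  · have := isIso_of_mono_of_ne_zero_comp i p hp
    have hp' : inv i ≫ p ≠ 0 := fun h0 => hp (by rw [← IsIso.hom_inv_id_assoc i p, h0, comp_zero])
    have : Mono p := by
      have := mono_of_nonzero_from_simple hp'
      rw [← IsIso.hom_inv_id_assoc i p]
      infer_instance
    have := isIso_of_mono_of_epi p
    rw [hL.iso_invariant ⟨asIso (inv p ≫ i)⟩, hL'.iso_invariant ⟨asIso (inv p ≫ i)⟩, h]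

/-- Length functions on a semi-Artinian category are determined by their values on the simple
objects. -/
lemma IsLengthFunction.eq_of_simple [IsGrothendieckAbelian.{w} C] (hC : IsSemiArtinian.{w} C)
    (hL : IsLengthFunction L) (hL' : IsLengthFunction L') (h : ∀ S : C, Simple S → L S = L' S)
    (M : C) : L M = L' M :=
  (hC M _ (isHereditaryTorsionClass_agreeOn.{w} hL hL')
    fun S _ => agreeOn_of_simple hL hL' (h S inferInstance)).eq

lemma multiplicity_obj_obj (π ρ : Sp C) [DecidableEq (Sp C)] :
    multiplicity π.obj ρ.obj = if π = ρ then 1 else 0 := by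
  split_ifs with h
  · rw [h, multiplicity_self]
  · refine multiplicity_eq_zero ⟨fun e => h ?_⟩
    rw [← Quotient.out_eq (s := simpleSetoid C) π, ← Quotient.out_eq (s := simpleSetoid C) ρ]
    exact Quotient.sound (s := simpleSetoid C) ⟨e⟩

/-- Only the term π = ρ survives, even where `μ π` is ∞, since ∞ · 0 = 0. -/
lemma tsum_mul_multiplicity_obj (μ : Sp C → ℝ≥0∞) (ρ : Sp C) :
    ∑' π : Sp C, μ π * multiplicity π.obj ρ.obj = μ ρ := by
  classical
  rw [tsum_eq_single ρ fun π hπ => by rw [multiplicity_obj_obj, if_neg hπ, mul_zero],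
    multiplicity_self, mul_one]

lemma exists_iso_obj (S : C) [Simple S] : ∃ π : Sp C, Nonempty (S ≅ π.obj) :=
  ⟨Quotient.mk (simpleSetoid C) ⟨S, inferInstance⟩,
    (simpleSetoid C).symm (Quotient.mk_out (s := simpleSetoid C) ⟨S, inferInstance⟩)⟩

end Uniqueness
end LengthFunctions

theorem theorem2p20 {C : Type u} [Category.{v} C] [Abelian C] [IsGrothendieckAbelian.{w} C]
    (hC : LengthFunctions.IsSemiArtinian.{w} C)
    (L : C → ℝ≥0∞) (hL : LengthFunctions.IsLengthFunction L) :
    (∀ π : LengthFunctions.Sp C,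
      LengthFunctions.IsLengthFunction (LengthFunctions.atomicLength π)) ∧
    (∀ M : C, L M = ∑' π : LengthFunctions.Sp C, L π.obj * LengthFunctions.atomicLength π M) ∧
    (∀ μ : LengthFunctions.Sp C → ℝ≥0∞,
      (∀ M : C, L M = ∑' π : LengthFunctions.Sp C, μ π * LengthFunctions.atomicLength π M) →
        ∀ π : LengthFunctions.Sp C, μ π = L π.obj) := by
  have hl (π : LengthFunctions.Sp C) :=
    LengthFunctions.isLengthFunction_multiplicity.{w} π.obj
  simp only [LengthFunctions.atomicLength_eq_multiplicity.{w}]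
  have hsum := LengthFunctions.IsLengthFunction.tsum_mul
    (fun π : LengthFunctions.Sp C => L π.obj) hl
  refine ⟨hl, hL.eq_of_simple hC hsum fun S _ => ?_, fun μ h π => ?_⟩
  · obtain ⟨π, e⟩ := LengthFunctions.exists_iso_obj S
    rw [hL.iso_invariant e, hsum.iso_invariant e]
    exact (LengthFunctions.tsum_mul_multiplicity_obj (fun π => L π.obj) π).symm
  · rw [h, LengthFunctions.tsum_mul_multiplicity_obj]
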